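/- Let $R$ be an arbitrary (unital, associative) ring; all modules are left $R$-modules. For a module $C$ let $\operatorname{Cogen}(C)$ be the class of modules isomorphic to a submodule of a product of copies of $C$, and for a map $\omega : I_0 \to I_1$ let $\mathcal{C}_\omega$ be the class of modules $X$ for which $\operatorname{Hom}_R(X,\omega)$ is surjective. An injective copresentation of a module $M$ is an exact sequence $0\to M\to I_0\xrightarrow{\omega} I_1$ with $I_0, I_1$ injective; it is minimal if $M\to I_0$ and $\operatorname{Im}\omega\hookrightarrow I_1$ are injective envelopes. The module $C$ is cosilting if $\operatorname{Cogen}(C)=\mathcal{C}_\omega$ for some injective copresentation $\omega$ of $C$, and a cosilting class is a class of the form $\operatorname{Cogen}(C)$ with $C$ cosilting. For a class $\mathcal{T}$ of modules put $$A(\mathcal{T})=\{X \mid \ker f\in\mathcal{T} \text{ for all } T\in\mathcal{T} \text{ and all } f:T\to X\}.$$ Let $C$ be a cosilting module, let $E$ be an injective cogenerator of the category of left $R$-modules, and let $0\to C_1\to C_0\xrightarrow{g} E$ be a minimal approximation sequence, i.e. an exact sequence in which $g$ is a $\operatorname{Cogen}(C)$-cover of $E$: $C_0\in\operatorname{Cogen}(C)$,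 every map from a module in $\operatorname{Cogen}(C)$ to $E$ factors through $g$, and every endomorphism $s$ of $C_0$ with $gs=g$ is an isomorphism. Let $\mathcal{T}={}^{\perp_0}C=\{X\mid \operatorname{Hom}_R(X,C)=0\}$. Then $$A(\mathcal{T})=\mathcal{C}_\sigma$$ for every minimal injective copresentation $0\to C_0\to I_0\xrightarrow{\sigma} I_1$ of $C_0$. Moreover, if $R$ is left artinian, then $A(\mathcal{T})$ is a cosilting class. -/

import Mathlib

universe u

open CategoryTheory

/-! Classes of left `R`-modules are predicates on `ModuleCat.{u} R`, where `R : Type u` is an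
arbitrary (unital, associative) ring; morphisms of modules are `R`-linear maps. -/

namespace Cosilting

variable {R : Type u} [Ring R]

/-- `Cogen C`: the modules isomorphic to a submodule of a product of copies of `C`. -/
def Cogen (C : ModuleCat.{u} R) : ObjectProperty (ModuleCat.{u} R) := fun X =>
  ∃ (ι : Type u) (f : X →ₗ[R] (ι → C)), Function.Injective f

/-- `^{⊥₀} C`: the modules `X` with `Hom_R(X, C) = 0`. -/
def leftPerp (C : ModuleCat.{u} R) : ObjectProperty (ModuleCat.{u} R) := fun X =>
  ∀ f : X →ₗ[R] C, f = 0

/-- `C_σ`, for a map `σ : I₀ → I₁`: the modules `X` such that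
`Hom_R(X, σ) : Hom_R(X, I₀) → Hom_R(X, I₁)` is surjective. -/
def copresClass {I₀ I₁ : ModuleCat.{u} R} (σ : I₀ →ₗ[R] I₁) :
    ObjectProperty (ModuleCat.{u} R) := fun X =>
  Function.Surjective (fun h : X →ₗ[R] I₀ => σ ∘ₗ h)

/-- `A(T)`: the modules `X` such that every map `f : T → X` with `T` in the given class has its
kernel in that class. -/
def classA (𝒯 : ObjectProperty (ModuleCat.{u} R)) : ObjectProperty (ModuleCat.{u} R) := fun X =>
  ∀ T : ModuleCat.{u} R, 𝒯 T → ∀ f : T →ₗ[R] X, 𝒯 (ModuleCat.of R (LinearMap.ker f))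

/-- `0 → M → I₀ → I₁` (with maps `i` and `σ`) is an injective copresentation of `M`. -/
structure IsInjCopresentation {M I₀ I₁ : ModuleCat.{u} R}
    (i : M →ₗ[R] I₀) (σ : I₀ →ₗ[R] I₁) : Prop where
  inj₀ : Module.Injective R I₀
  inj₁ : Module.Injective R I₁
  mono : Function.Injective i
  exact : Function.Exact i σ

/-- A submodule is essential if it meets every nonzero submodule nontrivially. -/
def IsEssential {M : ModuleCat.{u} R} (N : Submodule R M) : Prop :=
  ∀ L : Submodule R M, N ⊓ L = ⊥ → L = ⊥

/-- `0 → M → I₀ → I₁` is a minimal injective copresentation of `M`: the maps `M → I₀` and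
`coker (M → I₀) ≅ im σ → I₁` are injective envelopes. -/
structure IsMinInjCopresentation {M I₀ I₁ : ModuleCat.{u} R}
    (i : M →ₗ[R] I₀) (σ : I₀ →ₗ[R] I₁) : Prop extends IsInjCopresentation i σ where
  essential₀ : IsEssential (LinearMap.range i)
  essential₁ : IsEssential (LinearMap.range σ)

/-- `C` is a cosilting module: `Cogen C = C_ω` for some injective copresentation `ω` of `C`. -/
def IsCosilting (C : ModuleCat.{u} R) : Prop :=
  ∃ (I₀ I₁ : ModuleCat.{u} R) (i : C →ₗ[R] I₀) (ω : I₀ →ₗ[R] I₁),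
    IsInjCopresentation i ω ∧ Cogen C = copresClass ω

/-- A cosilting class is a class of the form `Cogen C` for a cosilting module `C`. -/
def IsCosiltingClass (P : ObjectProperty (ModuleCat.{u} R)) : Prop :=
  ∃ C : ModuleCat.{u} R, IsCosilting C ∧ P = Cogen C

/-- `E` is an injective cogenerator of the category of left `R`-modules. -/
structure IsInjCogenerator (E : ModuleCat.{u} R) : Prop where
  inj : Module.Injective R E
  cogen : ∀ X : ModuleCat.{u} R, Cogen E X

/-- `g : S → M` is a cover of `M` with respect to a class of modules: a right minimal precover. -/
structure IsCover (𝒮 : ObjectProperty (ModuleCat.{u} R)) {S M : ModuleCat.{u} R}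
    (g : S →ₗ[R] M) : Prop where
  mem : 𝒮 S
  factors : ∀ S' : ModuleCat.{u} R, 𝒮 S' → ∀ g' : S' →ₗ[R] M, ∃ h : S' →ₗ[R] S, g ∘ₗ h = g'
  minimal : ∀ s : S →ₗ[R] S, g ∘ₗ s = g → Function.Bijective s

/-- `0 → C₁ → C₀ → E` (with maps `k` and `g`) is a minimal approximation sequence for `C`: `E` is
an injective cogenerator, `g` is a `Cogen C`-cover of `E`, and `k` is a kernel of `g`. -/
structure IsMinApproxSequence (C : ModuleCat.{u} R) {C₁ C₀ E : ModuleCat.{u} R}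
    (k : C₁ →ₗ[R] C₀) (g : C₀ →ₗ[R] E) : Prop where
  injCogenerator : IsInjCogenerator E
  cover : IsCover (Cogen C) g
  mono : Function.Injective k
  exact : Function.Exact k g

end Cosilting

/-! Call modules in `leftPerp C` torsion. Since `C` is cosilting, the reject of `C` in any module is
torsion. The cover gives `Cogen C = Cogen C₀`, so torsion can be tested against `C₀`.

If `X` lies in `C_σ` and `f : T → X` has torsion source, every map `ker f → C₀` extends to `T`,
hence is zero. Conversely, let `X` lie in `A(𝒯)`. Pulling `σ` back along `φ : X → I₁` gives `G`
containing `C₀` as the kernel of `G → X`. The reject of `G` meets `C₀` in a torsion module, because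
`X` is in `A(𝒯)`; a torsion submodule of `C₀` is zero. So `C₀` embeds in a quotient of `G` lying in
`Cogen C`, and minimality of the cover splits this embedding. The splitting lifts `φ` on the
preimage of `im σ`, and essentiality of `im σ` makes this a lift everywhere.

Over an artinian ring it remains to see that `A(𝒯)` is closed under powers: a class `C_σ` that
contains `C₀` and is closed under powers is `Cogen D` for an explicit cosilting `D`. Each element of
a torsion module lies in a finitely generated torsion submodule, and a minimal torsion submodule
containing a given element of `ker f` is killed by all coordinates of `f` at once. The finite
generation rests on `cogen_of_fg`, a pure-injectivity argument: `C^J / C^(J)` lies in `Cogen C`, so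
finite sums in `C` extend to `C^J`, and these generalized sums glue partial lifts transfinitely. -/

namespace Cosilting

variable {R : Type u} [Ring R]

/-! ### Extension and factorization of maps into injectives -/

section Injective

variable {I M N : Type u} [AddCommGroup I] [AddCommGroup M] [AddCommGroup N]
  [Module R I] [Module R M] [Module R N]

theorem exists_extension_of_injective (hI : Module.Injective R I) (f : M →ₗ[R] N)
    (hf : Function.Injective f) (q : M →ₗ[R] I) : ∃ h : N →ₗ[R] I, h ∘ₗ f = q := by
  obtain ⟨h, hh⟩ := hI.out f hf q
  exact ⟨h, LinearMap.ext hh⟩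

/-- A map into an injective module that vanishes on the kernel of `p` factors through `p`, even
when `p` is not surjective. -/
theorem exists_factor_of_ker_le (hI : Module.Injective R I) (p : M →ₗ[R] N) (q : M →ₗ[R] I)
    (h : LinearMap.ker p ≤ LinearMap.ker q) : ∃ r : N →ₗ[R] I, r ∘ₗ p = q := by
  obtain ⟨r, hr⟩ := exists_extension_of_injective hI ((LinearMap.ker p).liftQ p le_rfl)
    (LinearMap.ker_eq_bot.1 (Submodule.ker_liftQ_eq_bot' _ p rfl)) ((LinearMap.ker p).liftQ q h)
  refine ⟨r, LinearMap.ext fun x => ?_⟩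
  simpa using LinearMap.congr_fun hr ((LinearMap.ker p).mkQ x)

end Injective

/-! ### Torsion and torsion-free modules of a cosilting module -/

section Basic

variable {C I₀ I₁ : ModuleCat.{u} R} {i : C →ₗ[R] I₀} {ω : I₀ →ₗ[R] I₁}

/-- A map into `I₀` killed by `ω` factors through the kernel `i` of `ω`. -/
theorem exists_lift_of_comp_eq_zero {M : Type u} [AddCommGroup M] [Module R M]
    (hi : Function.Injective i) (hex : Function.Exact i ω) (q : M →ₗ[R] I₀) (hq : ω ∘ₗ q = 0) :
    ∃ r : M →ₗ[R] C, i ∘ₗ r = q := by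
  have hr : ∀ x, q x ∈ LinearMap.range i := fun x =>
    (hex (q x)).1 (LinearMap.congr_fun hq x)
  refine ⟨(LinearEquiv.ofInjective i hi).symm.toLinearMap ∘ₗ q.codRestrict _ hr,
    LinearMap.ext fun x => ?_⟩
  have := (LinearEquiv.ofInjective i hi).apply_symm_apply (q.codRestrict _ hr x)
  exact congrArg Subtype.val this

theorem copresClass_of_injective (hi₁ : Module.Injective R I₁) {X Y : ModuleCat.{u} R}
    (f : X →ₗ[R] Y) (hf : Function.Injective f) (hY : copresClass ω Y) : copresClass ω X := by
  intro φ
  obtain ⟨h, rfl⟩ := exists_extension_of_injective hi₁ f hf φ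
  obtain ⟨ψ, rfl⟩ := hY h
  exact ⟨ψ ∘ₗ f, rfl⟩

/-- If `X` lies in the class of an injective copresentation of `C`, then maps to `C` extend along
the kernel of any map to `X`. -/
theorem exists_extension_of_exact (hω : IsInjCopresentation i ω)
    {X : ModuleCat.{u} R} (hX : copresClass ω X) {K M : Type u} [AddCommGroup K] [Module R K]
    [AddCommGroup M] [Module R M] {k : K →ₗ[R] M} {p : M →ₗ[R] X} (hk : Function.Injective k)
    (hkp : Function.Exact k p) (h : K →ₗ[R] C) : ∃ h' : M →ₗ[R] C, h' ∘ₗ k = h := by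
  obtain ⟨H, hH⟩ := exists_extension_of_injective hω.inj₀ k hk (i ∘ₗ h)
  -- On `im k = ker p` the map `H` takes values in `ker ω`, so `ω ∘ₗ H` factors through `p`. Lifting
  -- the factor along `ω` gives a correction of `H` that lands in `C`.
  obtain ⟨φ, hφ⟩ := exists_factor_of_ker_le hω.inj₁ p (ω ∘ₗ H) (by
    intro x hx
    obtain ⟨z, rfl⟩ := (hkp x).1 hx
    have := LinearMap.congr_fun hH z
    simp only [LinearMap.comp_apply] at this
    simp [this, hω.exact.apply_apply_eq_zero])
  obtain ⟨ψ, rfl⟩ := hX φ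
  obtain ⟨r, hr⟩ := exists_lift_of_comp_eq_zero hω.mono hω.exact (H - ψ ∘ₗ p) (by
    rw [LinearMap.comp_sub, ← hφ]; simp [LinearMap.comp_assoc])
  refine ⟨r, LinearMap.ext fun x => hω.mono ?_⟩
  have h1 := LinearMap.congr_fun hr (k x)
  have h2 := LinearMap.congr_fun hH x
  simp only [LinearMap.comp_apply, LinearMap.sub_apply, hkp.apply_apply_eq_zero, map_zero,
    sub_zero] at h1 h2 ⊢
  rw [h1, h2]

theorem cogen_iff {X : ModuleCat.{u} R} :
    Cogen C X ↔ ∀ x : X, x ≠ 0 → ∃ f : X →ₗ[R] C, f x ≠ 0 := by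
  constructor
  · rintro ⟨ι, f, hf⟩ x hx
    by_contra! h
    refine hx (hf ?_)
    rw [map_zero]
    exact funext fun j => h (LinearMap.proj j ∘ₗ f)
  · intro h
    refine ⟨X →ₗ[R] C, LinearMap.pi fun f => f, ?_⟩
    rw [← LinearMap.ker_eq_bot, LinearMap.ker_eq_bot']
    intro x hx
    by_contra hx0
    obtain ⟨f, hf⟩ := h x hx0
    exact hf (congrFun hx f)

theorem cogen_self (C : ModuleCat.{u} R) : Cogen C C :=
  cogen_iff.2 fun _ hx => ⟨LinearMap.id, hx⟩

theorem cogen_pi (X : ModuleCat.{u} R) (ι : Type u) : Cogen X (ModuleCat.of R (ι → X)) :=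
  ⟨ι, LinearMap.id, Function.injective_id⟩

theorem leftPerp_of_surjective {X Y : ModuleCat.{u} R} (f : X →ₗ[R] Y)
    (hf : Function.Surjective f) (hX : leftPerp C X) : leftPerp C Y := by
  intro g
  ext y
  obtain ⟨x, rfl⟩ := hf y
  exact LinearMap.congr_fun (hX (g ∘ₗ f)) x

theorem leftPerp_of_cogen {D X : ModuleCat.{u} R} (hD : Cogen C D) (hX : leftPerp C X) :
    leftPerp D X := by
  intro f
  ext x
  by_contra hx
  obtain ⟨g, hg⟩ := cogen_iff.1 hD _ hx
  exact hg (LinearMap.congr_fun (hX (g ∘ₗ f)) x)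

theorem eq_zero_of_leftPerp_of_cogen {X : ModuleCat.{u} R} (hX : leftPerp C X) (hX' : Cogen C X)
    (x : X) : x = 0 := by
  by_contra hx
  obtain ⟨g, hg⟩ := cogen_iff.1 hX' _ hx
  exact hg (LinearMap.congr_fun (hX g) x)

/-- The reject of `C` in `X`: the intersection of the kernels of all maps `X → C`. -/
def reject (C X : ModuleCat.{u} R) : Submodule R X := ⨅ f : X →ₗ[R] C, LinearMap.ker f

theorem mem_reject {X : ModuleCat.{u} R} {x : X} :
    x ∈ reject C X ↔ ∀ f : X →ₗ[R] C, f x = 0 := by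
  simp [reject, Submodule.mem_iInf]

theorem cogen_quotient_reject (C X : ModuleCat.{u} R) :
    Cogen C (ModuleCat.of R (X ⧸ reject C X)) := by
  rw [cogen_iff]
  intro y hy
  obtain ⟨x, rfl⟩ := Submodule.mkQ_surjective _ y
  have hx : x ∉ reject C X := fun h => hy ((Submodule.Quotient.mk_eq_zero _).2 h)
  rw [mem_reject] at hx
  push Not at hx
  obtain ⟨f, hf⟩ := hx
  exact ⟨(reject C X).liftQ f fun z hz => mem_reject.1 hz f, hf⟩

/-- The quotient by the reject lies in `Cogen C = C_ω`, so a map from the reject to `C` extends to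
`X`, and by definition every such extension vanishes on the reject. -/
theorem leftPerp_reject (hC : IsCosilting C) (X : ModuleCat.{u} R) :
    leftPerp C (ModuleCat.of R (reject C X)) := by
  obtain ⟨I₀, I₁, i, ω, hω, hCω⟩ := hC
  have hq := cogen_quotient_reject C X
  rw [hCω] at hq
  intro h
  obtain ⟨h', rfl⟩ := exists_extension_of_exact hω hq (Submodule.subtype_injective _)
    (LinearMap.exact_subtype_mkQ (reject C X)) h
  exact LinearMap.ext fun x => mem_reject.1 x.2 h'

end Basic

/-! ### The equality of `A(𝒯)` with `C_σ`, and the cosilting module of `C_σ` -/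

section ClassA

variable {C : ModuleCat.{u} R}

/-- Every class defined by an injective copresentation of a module cogenerating `C` is contained
in `A(^{⊥₀} C)`. -/
theorem classA_of_copresClass {C₀ I₀ I₁ : ModuleCat.{u} R} {i : C₀ →ₗ[R] I₀} {σ : I₀ →ₗ[R] I₁}
    (hσ : IsInjCopresentation i σ) (h₁ : Cogen C C₀) (h₂ : Cogen C₀ C) {X : ModuleCat.{u} R}
    (hX : copresClass σ X) : classA (leftPerp C) X := by
  intro T hT f
  refine leftPerp_of_cogen h₂ fun h => ?_
  obtain ⟨h', rfl⟩ := exists_extension_of_exact hσ hX (Submodule.subtype_injective _)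
    (LinearMap.exact_subtype_ker_map f) h
  rw [leftPerp_of_cogen h₁ hT h', LinearMap.zero_comp]

theorem cogen_of_cover {C₀ E : ModuleCat.{u} R} {g : C₀ →ₗ[R] E} (hE : IsInjCogenerator E)
    (hg : IsCover (Cogen C) g) {X : ModuleCat.{u} R} (hX : Cogen C X) : Cogen C₀ X := by
  rw [cogen_iff]
  intro x hx
  obtain ⟨f, hf⟩ := cogen_iff.1 (hE.cogen X) x hx
  obtain ⟨h, rfl⟩ := hg.factors X hX f
  exact ⟨h, fun h0 => hf (by simp [h0])⟩

/-- An embedding of the source of a `Cogen C`-cover of an injective module into a module of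
`Cogen C` splits. -/
theorem exists_retraction_of_cover {C₀ E F : ModuleCat.{u} R} {g : C₀ →ₗ[R] E}
    (hE : Module.Injective R E) (hg : IsCover (Cogen C) g) (hF : Cogen C F) (j : C₀ →ₗ[R] F)
    (hj : Function.Injective j) : ∃ r : F →ₗ[R] C₀, r ∘ₗ j = LinearMap.id := by
  obtain ⟨g', hg'⟩ := exists_extension_of_injective hE j hj g
  obtain ⟨h, rfl⟩ := hg.factors F hF g'
  have hs := hg.minimal (h ∘ₗ j) (by rw [← LinearMap.comp_assoc, hg'])
  refine ⟨(LinearEquiv.ofBijective _ hs).symm.toLinearMap ∘ₗ h, LinearMap.ext fun x => ?_⟩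
  exact (LinearEquiv.ofBijective _ hs).symm_apply_apply x

theorem copresClass_of_classA (hC : IsCosilting C) {C₀ E I₀ I₁ : ModuleCat.{u} R}
    {g : C₀ →ₗ[R] E} (hE : Module.Injective R E) (hg : IsCover (Cogen C) g)
    {i : C₀ →ₗ[R] I₀} {σ : I₀ →ₗ[R] I₁} (hσ : IsInjCopresentation i σ)
    (hess : IsEssential (LinearMap.range σ)) {X : ModuleCat.{u} R}
    (hX : classA (leftPerp C) X) : copresClass σ X := by
  intro φ
  -- the pullback of `φ` and `σ`
  let G : Submodule R (I₀ × X) :=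
    LinearMap.ker (σ ∘ₗ LinearMap.fst R I₀ X - φ ∘ₗ LinearMap.snd R I₀ X)
  have hG : ∀ z : G, σ z.1.1 = φ z.1.2 := fun z => by
    have := z.2
    rw [LinearMap.mem_ker] at this
    exact sub_eq_zero.1 this
  let a : G →ₗ[R] I₀ := LinearMap.fst R I₀ X ∘ₗ G.subtype
  let p : G →ₗ[R] X := LinearMap.snd R I₀ X ∘ₗ G.subtype
  let j : C₀ →ₗ[R] G := (LinearMap.inl R I₀ X ∘ₗ i).codRestrict G fun c => by
    simp [G, hσ.exact.apply_apply_eq_zero]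
  have haj : ∀ c, a (j c) = i c := fun c => rfl
  have hpj : ∀ c, p (j c) = 0 := fun c => rfl
  have hker : ∀ z, p z = 0 → ∃ c, j c = z := by
    intro z hz
    have h0 : σ z.1.1 = 0 := by
      rw [hG z]; change φ (p z) = 0; rw [hz, map_zero]
    obtain ⟨c, hc⟩ := (hσ.exact _).1 h0
    exact ⟨c, Subtype.ext (Prod.ext hc hz.symm)⟩
  let t : Submodule R G := reject C (ModuleCat.of R G)
  -- The kernel of `t → X` is torsion and embeds in `C₀`, which lies in `Cogen C`; hence it is zero.
  have hj : Function.Injective (t.mkQ ∘ₗ j) := by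
    rw [← LinearMap.ker_eq_bot, LinearMap.ker_eq_bot']
    intro c hc
    have hct : j c ∈ t := (Submodule.Quotient.mk_eq_zero _).1 hc
    have htor := hX (ModuleCat.of R t) (leftPerp_reject hC (ModuleCat.of R G)) (p ∘ₗ t.subtype)
    let b : LinearMap.ker (p ∘ₗ t.subtype) →ₗ[R] I₀ := a ∘ₗ t.subtype ∘ₗ Submodule.subtype _
    obtain ⟨r, hr⟩ := exists_lift_of_comp_eq_zero hσ.mono hσ.exact b (LinearMap.ext fun z => by
      have hz : p z.1.1 = 0 := z.2
      change σ (z.1.1.1.1) = 0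
      rw [hG]
      change φ (p z.1.1) = 0
      rw [hz, map_zero])
    have hr0 : r = 0 := leftPerp_of_cogen hg.mem htor r
    have := LinearMap.congr_fun hr ⟨⟨j c, hct⟩, hpj c⟩
    rw [hr0] at this
    have h2 : i c = 0 := this.symm.trans (map_zero i)
    exact hσ.mono (h2.trans (map_zero i).symm)
  obtain ⟨r, hr⟩ := exists_retraction_of_cover hE hg
    (cogen_quotient_reject C (ModuleCat.of R G)) (t.mkQ ∘ₗ j) hj
  obtain ⟨ψ, hψ⟩ := exists_factor_of_ker_le hσ.inj₀ p (a - i ∘ₗ r ∘ₗ t.mkQ) (by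
    intro z hz
    obtain ⟨c, rfl⟩ := hker z hz
    have : r (t.mkQ (j c)) = c := LinearMap.congr_fun hr c
    simp only [LinearMap.mem_ker, LinearMap.sub_apply, LinearMap.comp_apply, this, haj, sub_self])
  refine ⟨ψ, ?_⟩
  have hpre : ∀ z : G, σ (ψ (p z)) = φ (p z) := by
    intro z
    have := congrArg σ (LinearMap.congr_fun hψ z)
    simp only [LinearMap.comp_apply, LinearMap.sub_apply, map_sub,
      hσ.exact.apply_apply_eq_zero, sub_zero] at this
    exact this.trans (hG z)
  -- If `φ x - σ (ψ x) = σ y`, then `(y + ψ x, x)` lies in the pullback, where `ψ` already lifts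
  -- `φ`.
  have h0 : LinearMap.range (φ - σ ∘ₗ ψ) = ⊥ := by
    refine hess _ (eq_bot_iff.2 ?_)
    rintro _ ⟨⟨y, hy⟩, ⟨x, rfl⟩⟩
    let z : G := ⟨(y + ψ x, x), by simp [G, hy]⟩
    have := hpre z
    change φ x - σ (ψ x) = 0
    exact sub_eq_zero.2 this.symm
  exact (sub_eq_zero.1 (LinearMap.range_eq_bot.1 h0)).symm

/-- A class given by an injective copresentation `σ` is a cosilting class if it contains the
kernel of `σ` and is closed under powers. -/
theorem isCosiltingClass_copresClass {C₀ E I₀ I₁ : ModuleCat.{u} R} {i : C₀ →ₗ[R] I₀}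
    {σ : I₀ →ₗ[R] I₁} (hσ : IsInjCopresentation i σ) (hE : IsInjCogenerator E)
    (hC₀ : copresClass σ C₀)
    (hpow : ∀ (X : ModuleCat.{u} R) (ι : Type u), copresClass σ X →
      copresClass σ (ModuleCat.of R (ι → X))) :
    IsCosiltingClass (copresClass σ) := by
  have inj₀ := hσ.inj₀
  have inj₁ := hσ.inj₁
  have injE := hE.inj
  -- `D = ker w` is the universal module over `E` on which all maps `E → I₁` lift along `σ`; the
  -- kernel of `D → E` is `C₀^J`.
  let J : Type u := E →ₗ[R] I₁
  let J₀ : ModuleCat.{u} R := ModuleCat.of R (E × (J → I₀))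
  let J₁ : ModuleCat.{u} R := ModuleCat.of R (J → I₁)
  let w : (E × (J → I₀)) →ₗ[R] (J → I₁) := LinearMap.pi fun j =>
    j ∘ₗ LinearMap.fst R E (J → I₀) - σ ∘ₗ LinearMap.proj j ∘ₗ LinearMap.snd R E (J → I₀)
  have hw : ∀ z j, w z j = j z.1 - σ (z.2 j) := fun z j => rfl
  let D : ModuleCat.{u} R := ModuleCat.of R (LinearMap.ker w)
  have hcopres : IsInjCopresentation (M := D) (I₀ := J₀) (I₁ := J₁)
      (LinearMap.ker w).subtype w := by
    refine ⟨⟨fun {X Y} _ _ _ _ f hf q => ?_⟩, ?_, Submodule.subtype_injective _,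
      LinearMap.exact_subtype_ker_map w⟩
    · obtain ⟨h₁, e₁⟩ := exists_extension_of_injective injE f hf (LinearMap.fst R E (J → I₀) ∘ₗ q)
      obtain ⟨h₂, e₂⟩ := exists_extension_of_injective (I := J → I₀) inferInstance f hf
        (LinearMap.snd R E (J → I₀) ∘ₗ q)
      exact ⟨h₁.prod h₂, fun x => Prod.ext (LinearMap.congr_fun e₁ x) (LinearMap.congr_fun e₂ x)⟩
    · exact inferInstanceAs (Module.Injective R (J → I₁))
  have hclass : copresClass (I₀ := J₀) (I₁ := J₁) w = copresClass σ := by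
    funext X
    refine propext ⟨fun h φ => ?_, fun h φ => ?_⟩
    · obtain ⟨q, hq⟩ := h (LinearMap.pi fun _ => -φ)
      -- At the index `0 : J` the contribution of `E` vanishes, leaving a lift along `σ` alone.
      refine ⟨LinearMap.proj (0 : J) ∘ₗ LinearMap.snd R E (J → I₀) ∘ₗ q,
        LinearMap.ext fun x => ?_⟩
      have := congrFun (LinearMap.congr_fun hq x) (0 : J)
      change (0 : J) (q x).1 - σ ((q x).2 0) = - φ x at this
      rw [LinearMap.zero_apply, zero_sub, neg_inj] at this
      exact this
    · choose q hq using fun j : J => h (-(LinearMap.proj j ∘ₗ φ))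
      refine ⟨LinearMap.prod 0 (LinearMap.pi q), LinearMap.ext fun x => funext fun j => ?_⟩
      have := LinearMap.congr_fun (hq j) x
      change j 0 - σ (q j x) = φ x j
      change σ (q j x) = -(φ x j) at this
      rw [this, map_zero, zero_sub, neg_neg]
  have hD : copresClass σ D := by
    intro h
    -- correct `h` so that it vanishes on the kernel of `D → E`
    let e : LinearMap.ker w →ₗ[R] E := LinearMap.fst R E (J → I₀) ∘ₗ Submodule.subtype _
    let b : (J → C₀) →ₗ[R] LinearMap.ker w :=
      (LinearMap.inr R E (J → I₀) ∘ₗ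
        LinearMap.pi fun j => i ∘ₗ LinearMap.proj j).codRestrict _ fun c => by
      rw [LinearMap.mem_ker]
      funext j
      rw [hw]
      simp [hσ.exact.apply_apply_eq_zero]
    have hb : Function.Injective b := by
      intro c c' hcc
      funext j
      exact hσ.mono (congrFun (congrArg (fun z => z.1.2) hcc) j)
    have hbe : ∀ z, e z = 0 → ∃ c, b c = z := by
      intro z hz
      have : ∀ j, ∃ c, i c = z.1.2 j := fun j => (hσ.exact _).1 (by
        have h1 : w z.1 j = 0 := congrFun (LinearMap.mem_ker.1 z.2) j
        rw [hw] at h1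
        change j (e z) - _ = 0 at h1
        rw [hz, map_zero, zero_sub, neg_eq_zero] at h1
        exact h1)
      choose c hc using this
      exact ⟨c, Subtype.ext (Prod.ext hz.symm (funext hc))⟩
    obtain ⟨q, hq⟩ := hpow C₀ J hC₀ (h ∘ₗ b)
    obtain ⟨Q, hQ⟩ := exists_extension_of_injective inj₀ b hb q
    obtain ⟨j, hj⟩ := exists_factor_of_ker_le inj₁ e (h - σ ∘ₗ Q) (by
      intro z hz
      obtain ⟨c, rfl⟩ := hbe z hz
      have h1 : σ (q c) = h (b c) := LinearMap.congr_fun hq c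
      have h2 : Q (b c) = q c := LinearMap.congr_fun hQ c
      rw [LinearMap.mem_ker, LinearMap.sub_apply, LinearMap.comp_apply, h2, h1, sub_self])
    -- The corrected map is `j ∘ₗ e`, which the `j`-th coordinate of `D` lifts by the equation
    -- defining `D`.
    let s : LinearMap.ker w →ₗ[R] I₀ :=
      LinearMap.proj j ∘ₗ LinearMap.snd R E (J → I₀) ∘ₗ Submodule.subtype _
    refine ⟨Q + s, LinearMap.ext fun z => ?_⟩
    have h1 : w z.1 j = 0 := congrFun (LinearMap.mem_ker.1 z.2) j
    rw [hw, sub_eq_zero] at h1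
    have h2 : j (e z) = h z - σ (Q z) := LinearMap.congr_fun hj z
    change σ (Q z + s z) = h z
    rw [map_add]
    have h3 : σ (s z) = h z - σ (Q z) := h1.symm.trans h2
    rw [h3, add_sub_cancel]
  have hcogen : Cogen D = copresClass σ := by
    funext X
    refine propext ⟨?_, fun h => cogen_iff.2 fun x hx => ?_⟩
    · rintro ⟨ι, f, hf⟩
      exact copresClass_of_injective inj₁ (Y := ModuleCat.of R (ι → D)) f hf (hpow D ι hD)
    · obtain ⟨e, he⟩ := cogen_iff.1 (hE.cogen X) x hx
      choose a ha using fun j : J => h (j ∘ₗ e)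
      refine ⟨(e.prod (LinearMap.pi a)).codRestrict (LinearMap.ker w) fun y => ?_, fun h0 => ?_⟩
      · rw [LinearMap.mem_ker]
        funext j
        rw [hw]
        exact sub_eq_zero.2 (LinearMap.congr_fun (ha j) y).symm
      · exact he (congrArg (fun z => z.1.1) h0)
  exact ⟨D, ⟨J₀, J₁, _, w, hcopres, hcogen.trans hclass.symm⟩, hcogen.symm⟩

end ClassA

/-! ### Large almost disjoint families -/

section AlmostDisjoint

open Cardinal

/-- The iterated power types of `K`. -/
def iterPow (K : Type u) : ℕ → Type u
  | 0 => K
  | n + 1 => Set (iterPow K n)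

theorem aleph0_le_iterPow (K : Type u) [Infinite K] (n : ℕ) : ℵ₀ ≤ #(iterPow K n) := by
  induction n with
  | zero => exact aleph0_le_mk K
  | succ n ih => exact ih.trans ((cantor _).le.trans_eq (mk_set).symm)

theorem mk_iterPow_mono (K : Type u) : Monotone fun n => #(iterPow K n) :=
  monotone_nat_of_le_succ fun _ => (cantor _).le.trans_eq (mk_set).symm

/-- There is a family of pairwise almost disjoint sequences in a type `Λ`, indexed by a type `B`
that is so large that `Set B` does not embed into `Λ → K`. -/
theorem exists_almostDisjoint (K : Type u) [Infinite K] :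
    ∃ (Λ B : Type u) (s : B → ℕ → Λ), (∀ b, Function.Injective (s b)) ∧
      (∀ b b', b ≠ b' → ∀ᶠ n in Filter.cofinite, ∀ m, s b' m ≠ s b n) ∧
      ∀ F : Set B → Λ → K, ¬ Function.Injective F := by
  -- `Λ` is the set of nodes of a tree and `B` its set of branches; distinct branches share only
  -- finitely many initial segments.
  refine ⟨Σ n : ℕ, (m : Fin n) → iterPow K m, (n : ℕ) → iterPow K n,
    fun b n => ⟨n, fun m => b m⟩, fun b n n' h => congrArg Sigma.fst h, ?_, fun F hF => ?_⟩
  · intro b b' hbb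
    obtain ⟨N, hN⟩ := Function.ne_iff.1 hbb
    rw [Nat.cofinite_eq_atTop]
    filter_upwards [Filter.eventually_gt_atTop N] with n hn m h
    have hmn : m = n := congrArg Sigma.fst h
    subst hmn
    exact hN (congrFun (eq_of_heq (Sigma.mk.inj h).2) ⟨N, hn⟩).symm
  · have h1 : #(Σ n : ℕ, (m : Fin n) → iterPow K m) ≤ #(Σ n : ℕ, iterPow K n) := by
      rw [mk_sigma, mk_sigma]
      refine sum_le_sum _ _ fun n => ?_
      rw [mk_pi]
      calc Cardinal.prod (fun m : Fin n => #(iterPow K m))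
          ≤ Cardinal.prod (fun _ : Fin n => #(iterPow K n)) :=
            prod_le_prod _ _ fun m => mk_iterPow_mono K m.2.le
        _ ≤ #(iterPow K n) := by
            simpa using power_nat_le (n := n) (aleph0_le_iterPow K n)
    -- With `κₙ = #(iterPow K n)`, one has `#(Λ → K) ≤ ∏ κₙ^κₙ = ∏ κₙ₊₁ ≤ ∏ κₙ = #B < #(Set B)`.
    have h2 : #((n : ℕ) → iterPow K n → K) ≤ #((n : ℕ) → iterPow K (n + 1)) := by
      rw [mk_pi, mk_pi]
      refine prod_le_prod _ _ fun n => ?_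
      calc #(iterPow K n → K) = #K ^ #(iterPow K n) := by simp
        _ ≤ #(iterPow K n) ^ #(iterPow K n) :=
            power_le_power_right (mk_iterPow_mono K (Nat.zero_le n))
        _ = #(iterPow K (n + 1)) := (power_self_eq (aleph0_le_iterPow K n)).trans (mk_set).symm
    have h3 : #((n : ℕ) → iterPow K (n + 1)) ≤ #((n : ℕ) → iterPow K n) := by
      obtain ⟨k⟩ : Nonempty K := inferInstance
      refine mk_le_of_injective (f := fun b n => match n with
        | 0 => k
        | n + 1 => b n) fun b b' h => funext fun n => congrFun h (n + 1)
    have h4 : #((Σ n : ℕ, (m : Fin n) → iterPow K m) → K) ≤ #((n : ℕ) → iterPow K n) :=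
      calc #((Σ n : ℕ, (m : Fin n) → iterPow K m) → K)
          = #K ^ #(Σ n : ℕ, (m : Fin n) → iterPow K m) := by rw [← power_def]
        _ ≤ #K ^ #(Σ n : ℕ, iterPow K n) :=
            power_le_power_left (mk_ne_zero K) h1
        _ = #((Σ n : ℕ, iterPow K n) → K) := by rw [← power_def]
        _ = #((n : ℕ) → iterPow K n → K) :=
            mk_congr (Equiv.piCurry fun (n : ℕ) (_ : iterPow K n) => K)
        _ ≤ _ := h2.trans h3
    have h5 := (mk_le_of_injective hF).trans h4
    rw [mk_set] at h5
    exact (cantor _).not_ge h5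

end AlmostDisjoint

/-! ### Powers modulo finitely supported families, and generalized sums -/

section Powers

/-- The finitely supported families, as a submodule of all families. -/
noncomputable def finsuppSubmodule (R : Type u) [Ring R] (C : Type u) [AddCommGroup C]
    [Module R C] (J : Type*) : Submodule R (J → C) :=
  LinearMap.range (Finsupp.lcoeFun : (J →₀ C) →ₗ[R] J → C)

theorem mem_finsuppSubmodule {C : Type u} [AddCommGroup C] [Module R C] {J : Type*} {c : J → C} :
    c ∈ finsuppSubmodule R C J ↔ ∀ᶠ j in Filter.cofinite, c j = 0 := by
  rw [Filter.eventually_cofinite]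
  constructor
  · rintro ⟨f, rfl⟩
    exact f.hasFiniteSupport
  · intro h
    exact ⟨Finsupp.ofSupportFinite c h, rfl⟩

/-- Extension by zero along a map `s`, as a linear map. -/
noncomputable def extendZero {C : Type u} [AddCommGroup C] [Module R C] {J Λ : Type*} (s : J → Λ) :
    (J → C) →ₗ[R] (Λ → C) where
  toFun c := Function.extend s c 0
  map_add' c c' := by simpa using Function.extend_add s c c' (0 : Λ → C) 0
  map_smul' r c := by simpa using Function.extend_smul r s c (0 : Λ → C)

variable {C I₀ I₁ : ModuleCat.{u} R} {i : C →ₗ[R] I₀} {ω : I₀ →ₗ[R] I₁}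

/-- If a sum of sequences placed on pairwise almost disjoint sets is finitely supported, then each
of the sequences is. -/
theorem finsuppSubmodule_of_sum_extendZero {Λ B : Type u} {s : B → ℕ → Λ}
    (hs : ∀ b, Function.Injective (s b))
    (hd : ∀ b b', b ≠ b' → ∀ᶠ n in Filter.cofinite, ∀ m, s b' m ≠ s b n) (y : B →₀ (ℕ → C))
    (hy : (y.sum fun b c => extendZero (R := R) (s b) c) ∈ finsuppSubmodule R C Λ) (b : B) :
    y b ∈ finsuppSubmodule R C ℕ := by
  rw [mem_finsuppSubmodule] at hy ⊢
  have h1 := (hs b).tendsto_cofinite.eventually hy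
  have h2 : ∀ᶠ n in Filter.cofinite, ∀ b' ∈ y.support, b ≠ b' → ∀ m, s b' m ≠ s b n := by
    rw [Filter.eventually_all_finset]
    intro b' _
    by_cases hbb : b = b'
    · exact Filter.Eventually.of_forall fun n h => absurd hbb h
    · filter_upwards [hd b b' hbb] with n hn _ using hn
  filter_upwards [h1, h2] with n hn1 hn2
  rw [← hn1, Finsupp.sum, Finset.sum_apply, Finset.sum_eq_single b]
  · exact ((hs b).extend_apply _ _ n).symm
  · intro b' hb' hne
    refine Function.extend_apply' _ _ _ ?_
    rintro ⟨m, hm⟩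
    exact hn2 b' hb' hne.symm m hm
  · intro hb
    rw [Finsupp.notMem_support_iff.1 hb, map_zero, Pi.zero_apply]

theorem extendZero_mem_finsuppSubmodule {J Λ : Type*} {s : J → Λ} (hs : Function.Injective s)
    {c : J → C} (hc : c ∈ finsuppSubmodule R C J) :
    extendZero (R := R) s c ∈ finsuppSubmodule R C Λ := by
  rw [mem_finsuppSubmodule, Filter.eventually_cofinite] at hc ⊢
  refine (hc.image s).subset fun l hl => ?_
  by_cases h : ∃ j, s j = l
  · obtain ⟨j, rfl⟩ := h
    exact ⟨j, fun h0 => hl ((hs.extend_apply _ _ j).trans h0), rfl⟩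
  · exact absurd (Function.extend_apply' _ _ _ h) hl

theorem eq_zero_of_mem_finsuppSubmodule {J : Type*} {M : Type*} [AddCommGroup M] [Module R M]
    [DecidableEq J] {θ : (J → C) →ₗ[R] M} (h : ∀ j (c : C), θ (Pi.single j c) = 0) {c : J → C}
    (hc : c ∈ finsuppSubmodule R C J) : θ c = 0 := by
  obtain ⟨f, rfl⟩ := hc
  have : θ ∘ₗ Finsupp.lcoeFun = 0 := Finsupp.lhom_ext fun j c => by
    have h0 : (Finsupp.lcoeFun (R := R) (Finsupp.single j c) : J → C) = Pi.single j c :=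
      Finsupp.single_eq_pi_single j c
    simp only [LinearMap.comp_apply, LinearMap.zero_apply]
    rw [← h j c, ← h0]
  exact LinearMap.congr_fun this f

open Classical in
-- A counting argument. Almost disjointness embeds the direct sum of `B` copies of `C^ℕ / C^(ℕ)` in
-- `C^Λ / C^(Λ)`. For each `U ⊆ B`, the map that is `φ` on the copies in `U` and zero on the others
-- extends to this quotient and, on `C^Λ`, lifts along `ω`. If `φ` has no lift, these lifts are
-- already distinguished by their values on single coordinates, and there are too many of them.
theorem cogen_pi_nat_quotient (hω : IsInjCopresentation i ω) (hC : Cogen C = copresClass ω) :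
    Cogen C (ModuleCat.of R ((ℕ → C) ⧸ finsuppSubmodule R C ℕ)) := by
  rw [hC]
  intro φ
  by_contra hφ
  -- `C → I₀` records a lift on one coordinate; the second summand only ensures infinitude.
  obtain ⟨Λ, B, s, hs, hd, hcard⟩ := exists_almostDisjoint ((C → I₀) ⊕ ULift.{u} ℕ)
  let p : (B →₀ (ℕ → C)) →ₗ[R] ((Λ → C) ⧸ finsuppSubmodule R C Λ) :=
    (finsuppSubmodule R C Λ).mkQ ∘ₗ Finsupp.lsum ℕ fun b => extendZero (s b)
  let q (U : Set B) : (B →₀ (ℕ → C)) →ₗ[R] I₁ :=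
    Finsupp.lsum ℕ fun b => if b ∈ U then φ ∘ₗ (finsuppSubmodule R C ℕ).mkQ else 0
  have hker : ∀ U, LinearMap.ker p ≤ LinearMap.ker (q U) := by
    intro U y hy
    have hy' := (Submodule.Quotient.mk_eq_zero _).1 (LinearMap.mem_ker.1 hy)
    rw [LinearMap.mem_ker]
    change y.sum _ = 0
    refine Finset.sum_eq_zero fun b _ => ?_
    have hb : (finsuppSubmodule R C ℕ).mkQ (y b) = 0 := (Submodule.Quotient.mk_eq_zero _).2
      (finsuppSubmodule_of_sum_extendZero hs hd y hy' b)
    by_cases hU : b ∈ U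
    · simp only [hU, if_true]
      change φ ((finsuppSubmodule R C ℕ).mkQ (y b)) = 0
      rw [hb, map_zero]
    · simp [hU]
  choose Φ hΦ using fun U => exists_factor_of_ker_le hω.inj₁ p (q U) (hker U)
  have hΛ : copresClass ω (ModuleCat.of R (Λ → C)) := hC ▸ cogen_pi C Λ
  choose ψ hψ using fun U => hΛ (Φ U ∘ₗ (finsuppSubmodule R C Λ).mkQ)
  have hval : ∀ U b y, ω (ψ U (extendZero (R := R) (s b) y)) =
      if b ∈ U then φ ((finsuppSubmodule R C ℕ).mkQ y) else 0 := by
    intro U b y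
    have h1 := LinearMap.congr_fun (hψ U) (extendZero (R := R) (s b) y)
    have h2 := LinearMap.congr_fun (hΦ U) (Finsupp.single b y)
    have h3 : p (Finsupp.single b y) = (finsuppSubmodule R C Λ).mkQ (extendZero (R := R) (s b) y) := by
      simp [p]
    have h4 : q U (Finsupp.single b y) =
        if b ∈ U then φ ((finsuppSubmodule R C ℕ).mkQ y) else 0 := by
      by_cases hU : b ∈ U <;> simp [q, hU]
    rw [LinearMap.comp_apply, h3, h4] at h2
    exact h1.trans h2
  have key : ∀ U V, (∀ l c, ψ U (Pi.single l c) = ψ V (Pi.single l c)) → U ⊆ V := by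
    intro U V hUV b hU
    by_contra hV
    -- For `b` in `U` but not in `V`, the difference restricted to the `b`-th sequence kills finite
    -- families and lifts `φ`.
    refine hφ ⟨(finsuppSubmodule R C ℕ).liftQ ((ψ U - ψ V) ∘ₗ extendZero (s b)) fun c hc => ?_, ?_⟩
    · exact eq_zero_of_mem_finsuppSubmodule (θ := ψ U - ψ V)
        (fun l c => sub_eq_zero.2 (hUV l c)) (extendZero_mem_finsuppSubmodule (hs b) hc)
    · refine LinearMap.ext fun z => ?_
      obtain ⟨y, rfl⟩ := Submodule.mkQ_surjective _ z
      change ω (ψ U (extendZero (R := R) (s b) y) - ψ V (extendZero (R := R) (s b) y)) = _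
      rw [map_sub, hval, hval, if_pos hU, if_neg hV, sub_zero]
  refine hcard (fun U l => Sum.inl fun c => ψ U (Pi.single l c)) fun U V hUV => ?_
  have h : ∀ l c, ψ U (Pi.single l c) = ψ V (Pi.single l c) := fun l c =>
    congrFun (Sum.inl.inj (congrFun hUV l)) c
  exact (key U V h).antisymm (key V U fun l c => (h l c).symm)

/-- A nonzero class has infinite support; restriction to a countably infinite part of it reduces to
`ℕ`. -/
theorem cogen_pi_quotient (hω : IsInjCopresentation i ω) (hC : Cogen C = copresClass ω)
    (J : Type u) : Cogen C (ModuleCat.of R ((J → C) ⧸ finsuppSubmodule R C J)) := by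
  rw [cogen_iff]
  intro z hz
  obtain ⟨c, rfl⟩ := Submodule.mkQ_surjective _ z
  have hc : c ∉ finsuppSubmodule R C J := fun h => hz ((Submodule.Quotient.mk_eq_zero _).2 h)
  rw [mem_finsuppSubmodule, Filter.eventually_cofinite] at hc
  let e := Set.Infinite.natEmbedding _ hc
  have he : Function.Injective fun n => (e n).1 := Subtype.val_injective.comp e.injective
  let p : (J → C) →ₗ[R] ((ℕ → C) ⧸ finsuppSubmodule R C ℕ) :=
    (finsuppSubmodule R C ℕ).mkQ ∘ₗ LinearMap.funLeft R C fun n => (e n).1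
  have hp : p c ≠ 0 := by
    intro h0
    have h1 := (Submodule.Quotient.mk_eq_zero _).1 h0
    rw [mem_finsuppSubmodule] at h1
    obtain ⟨n, hn⟩ := h1.exists
    exact (e n).2 hn
  obtain ⟨f, hf⟩ := cogen_iff.1 (cogen_pi_nat_quotient hω hC) _ hp
  refine ⟨(finsuppSubmodule R C J).liftQ (f ∘ₗ p) fun x hx => ?_, hf⟩
  rw [mem_finsuppSubmodule] at hx
  have h0 : p x = 0 := (Submodule.Quotient.mk_eq_zero _).2
    (mem_finsuppSubmodule.2 (he.tendsto_cofinite.eventually hx))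
  rw [LinearMap.mem_ker, LinearMap.comp_apply, h0, map_zero]

/-- Summation of finitely supported families in `I₀` extends to arbitrary families, in such a way
that families in the kernel of `ω` have their sum in the kernel of `ω`. -/
theorem exists_sum_extension (hω : IsInjCopresentation i ω) (hC : Cogen C = copresClass ω)
    (J : Type u) [DecidableEq J] : ∃ S : (J → I₀) →ₗ[R] I₀, (∀ j a, S (Pi.single j a) = a) ∧
      ∀ c : J → I₀, (∀ j, ω (c j) = 0) → ω (S c) = 0 := by
  have hq := cogen_pi_quotient hω hC J
  rw [hC] at hq
  obtain ⟨S', hS'⟩ := exists_extension_of_exact hω hq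
    (k := (Finsupp.lcoeFun : (J →₀ C) →ₗ[R] J → C)) (p := (finsuppSubmodule R C J).mkQ)
    DFunLike.coe_injective (fun c => Submodule.Quotient.mk_eq_zero (finsuppSubmodule R C J))
    (Finsupp.lsum ℕ fun _ => LinearMap.id)
  -- The finite sum on `I₀^(J)` and the extended sum on `C^J` agree on their overlap `C^(J)`, so
  -- they glue inside `I₀^J` and extend by injectivity.
  let p : ((J →₀ I₀) × (J → C)) →ₗ[R] (J → I₀) :=
    LinearMap.coprod Finsupp.lcoeFun (LinearMap.pi fun j => i ∘ₗ LinearMap.proj j)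
  let q : ((J →₀ I₀) × (J → C)) →ₗ[R] I₀ :=
    LinearMap.coprod (Finsupp.lsum ℕ fun _ => LinearMap.id) (i ∘ₗ S')
  obtain ⟨S, hS⟩ := exists_factor_of_ker_le hω.inj₀ p q (by
    rintro ⟨f, c⟩ hfc
    have h1 : ∀ j, f j + i (c j) = 0 := fun j => congrFun (LinearMap.mem_ker.1 hfc) j
    obtain ⟨c', rfl⟩ : ∃ c' : J →₀ C, ⇑c' = c := by
      refine ⟨Finsupp.ofSupportFinite c (f.hasFiniteSupport.subset fun j hj h0 => hj ?_), rfl⟩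
      have := h1 j
      rw [h0, zero_add] at this
      exact hω.mono (this.trans (map_zero i).symm)
    have h2 : f = -(Finsupp.mapRange.linearMap i c') := by
      ext j
      exact eq_neg_of_add_eq_zero_left (h1 j)
    have h3 : S' c' = c'.sum fun _ a => a := LinearMap.congr_fun hS' c'
    have h4 : q (f, c') = (f.sum fun _ a => a) + i (S' c') := rfl
    rw [LinearMap.mem_ker, h4, h3, h2, Finsupp.sum_neg_index fun _ => rfl,
      Finsupp.mapRange.linearMap_apply,
      Finsupp.sum_mapRange_index (fun _ => neg_zero)]
    simp [Finsupp.sum, map_sum])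
  refine ⟨S, fun j a => ?_, fun c hc => ?_⟩
  · have := LinearMap.congr_fun hS (Finsupp.single j a, 0)
    simpa [p, q, Finsupp.single_eq_pi_single] using this
  · choose c' hc' using fun j => (hω.exact _).1 (hc j)
    obtain rfl : (fun j => i (c' j)) = c := funext hc'
    have h1 := LinearMap.congr_fun hS (0, c')
    have h2 : p (0, c') = fun j => i (c' j) := by
      ext j; simp [p]
    have h3 : q (0, c') = i (S' c') := by simp [q]
    rw [LinearMap.comp_apply, h2, h3] at h1
    rw [h1, hω.exact.apply_apply_eq_zero]

end Powers

/-! ### Reduction to finitely generated submodules; closure under powers -/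

section FinitelyGenerated

variable {C I₀ I₁ : ModuleCat.{u} R} {i : C →ₗ[R] I₀} {ω : I₀ →ₗ[R] I₁}

open Classical in
/-- Partial lifts of `φ` along `ω` on an increasing well-ordered family of subsets can be glued. -/
theorem exists_lift_of_wellOrdered (hω : IsInjCopresentation i ω) (hC : Cogen C = copresClass ω)
    {X : ModuleCat.{u} R} (φ : X →ₗ[R] I₁) {J : Type u} [LinearOrder J] [WellFoundedLT J]
    (Y : J → Set X) (hY : Monotone Y)
    (h : ∀ j, ∃ ψ : X →ₗ[R] I₀, ∀ x ∈ Y j, ω (ψ x) = φ x) :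
    ∃ ψ : X →ₗ[R] I₀, ∀ j, ∀ x ∈ Y j, ω (ψ x) = φ x := by
  choose ψ hψ using h
  obtain ⟨S, hS₁, hS₂⟩ := exists_sum_extension hω hC J
  let T (d : J → X →ₗ[R] I₀) : X →ₗ[R] I₀ := S ∘ₗ LinearMap.pi d
  have hT : ∀ d x, T d x = S fun j => d j x := fun d x => rfl
  -- `d j` corrects the generalized sum of the earlier terms to `ψ j`. On `Y j` the later terms take
  -- values in `ker ω`, so their generalized sum does too and leaves the lift intact.
  let d : J → X →ₗ[R] I₀ := wellFounded_lt.fix fun j rec =>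
    ψ j - T fun k => if hk : k < j then rec k hk else 0
  have hd : ∀ j, d j = ψ j - T fun k => if k < j then d k else 0 := by
    intro j
    have := wellFounded_lt.fix_eq (C := fun _ : J => X →ₗ[R] I₀) (fun j rec =>
      ψ j - T fun k => if hk : k < j then rec k hk else 0) j
    simpa only [dite_eq_ite] using this
  have key : ∀ (j : J) (e : J → X →ₗ[R] I₀), (∀ k ≤ j, e k = d k) → ∀ x ∈ Y j,
      (∀ k, j < k → ω (e k x) = 0) → ω (T e x) = φ x := by
    intro j e he x hx hk
    have h1 : (fun k => e k x) = (fun k => (if k < j then d k else 0) x) +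
        Pi.single j (d j x) + fun k => if j < k then e k x else 0 := by
      funext k
      rcases lt_trichotomy k j with hkj | rfl | hkj
      · simp [hkj, hkj.not_gt, hkj.ne, he k hkj.le]
      · simp [he k le_rfl]
      · simp [hkj, hkj.not_gt, hkj.ne']
    have h2 : d j x = ψ j x - S fun k => (if k < j then d k else 0) x := by
      conv_lhs => rw [hd j]
      rfl
    rw [hT, h1, map_add, map_add S, hS₁, h2, add_sub_cancel, map_add, hψ j x hx, hS₂, add_zero]
    intro k
    by_cases hjk : j < k
    · simp [hjk, hk k hjk]
    · simp [hjk]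
  have hd₀ : ∀ k j, j < k → ∀ x ∈ Y j, ω (d k x) = 0 := by
    intro k
    induction k using WellFoundedLT.induction with
    | ind k ih =>
      intro j hjk x hx
      rw [hd k, LinearMap.sub_apply, map_sub, hψ k x (hY hjk.le hx), sub_eq_zero]
      refine (key j _ (fun l hl => if_pos (hl.trans_lt hjk)) x hx fun l hl => ?_).symm
      by_cases hlk : l < k
      · simp only [hlk, if_true]
        exact ih l hlk j hl x hx
      · simp [hlk]
  exact ⟨T d, fun j x hx => key j d (fun _ _ => rfl) x hx fun k hk => hd₀ k j hk x hx⟩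

/-- Induction on cardinality: an infinite set enumerated by its initial ordinal is an increasing
union of smaller sets, whose lifts are glued. -/
theorem exists_lift_on_set (hω : IsInjCopresentation i ω) (hC : Cogen C = copresClass ω)
    {X : ModuleCat.{u} R} (φ : X →ₗ[R] I₁)
    (h : ∀ s : Set X, s.Finite → ∃ ψ : X →ₗ[R] I₀, ∀ x ∈ s, ω (ψ x) = φ x) (s : Set X) :
    ∃ ψ : X →ₗ[R] I₀, ∀ x ∈ s, ω (ψ x) = φ x := by
  induction hc : Cardinal.mk s using WellFoundedLT.induction generalizing s with
  | ind c ih =>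
    by_cases hfin : s.Finite
    · exact h s hfin
    have hinf : Cardinal.aleph0 ≤ Cardinal.mk s :=
      Cardinal.infinite_iff.1 (Set.infinite_coe_iff.2 hfin)
    obtain ⟨e⟩ : Nonempty (c.ord.ToType ≃ s) := Cardinal.eq.1 (by simp [hc])
    obtain ⟨ψ, hψ⟩ := exists_lift_of_wellOrdered hω hC φ
      (fun j : c.ord.ToType => (fun k => (e k : X)) '' Set.Iic j)
      (fun j k hjk => Set.image_mono (Set.Iic_subset_Iic.2 hjk)) (fun j => by
        refine ih _ ?_ _ rfl
        refine Cardinal.mk_image_le.trans_lt ?_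
        rw [← Set.Iio_insert]
        refine Cardinal.mk_insert_le.trans_lt
          (Cardinal.add_lt_of_lt (hc ▸ hinf) ?_ (Cardinal.one_lt_aleph0.trans_le (hc ▸ hinf)))
        simpa using Cardinal.mk_Iio_lt j)
    refine ⟨ψ, fun x hx => hψ (e.symm ⟨x, hx⟩) x ⟨_, Set.mem_Iic.2 le_rfl, by simp⟩⟩

/-- A cosilting class is determined by finitely generated submodules. -/
theorem cogen_of_fg (hC : IsCosilting C) {X : ModuleCat.{u} R}
    (h : ∀ N : Submodule R X, N.FG → Cogen C (ModuleCat.of R N)) : Cogen C X := by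
  obtain ⟨I₀, I₁, i, ω, hω, hCω⟩ := hC
  rw [hCω] at h ⊢
  intro φ
  obtain ⟨ψ, hψ⟩ := exists_lift_on_set hω hCω φ (fun s hs => by
    obtain ⟨ψ, hψ⟩ := h (Submodule.span R s) (Submodule.fg_span hs)
      (φ ∘ₗ (Submodule.span R s).subtype)
    obtain ⟨ψ', hψ'⟩ := exists_extension_of_injective hω.inj₀ (Submodule.span R s).subtype
      (Submodule.subtype_injective _) ψ
    refine ⟨ψ', fun x hx => ?_⟩
    have h1 : ψ' x = ψ ⟨x, Submodule.subset_span hx⟩ :=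
      LinearMap.congr_fun hψ' ⟨x, Submodule.subset_span hx⟩
    rw [h1]
    exact LinearMap.congr_fun hψ ⟨x, Submodule.subset_span hx⟩) Set.univ
  exact ⟨ψ, LinearMap.ext fun x => hψ x trivial⟩

/-- A map to `C` factoring through a torsion quotient vanishes. -/
theorem eq_zero_of_leftPerp_of_ker_le {X : ModuleCat.{u} R} (hX : leftPerp C X) {M : Type u}
    [AddCommGroup M] [Module R M] (p : M →ₗ[R] X) (hp : Function.Surjective p) (q : M →ₗ[R] C)
    (hpq : LinearMap.ker p ≤ LinearMap.ker q) : q = 0 := by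
  have h := hX ((LinearMap.ker p).liftQ q hpq ∘ₗ (p.quotKerEquivOfSurjective hp).symm.toLinearMap)
  ext x
  have := LinearMap.congr_fun h (p x)
  rw [LinearMap.comp_apply, LinearEquiv.coe_coe,
    (LinearEquiv.symm_apply_eq _).2 (p.quotKerEquivOfSurjective_apply_mk hp x).symm] at this
  simpa using this

/-- Stated for a single `f` so that `N'` need not be torsion: below it is applied to a module that
is torsion only modulo `U`. -/
theorem leftPerp_sup {T : ModuleCat.{u} R} {N N' : Submodule R T}
    (hN : leftPerp C (ModuleCat.of R N)) (f : ↥(N ⊔ N') →ₗ[R] C)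
    (hf : f ∘ₗ Submodule.inclusion le_sup_right = 0) : f = 0 := by
  refine LinearMap.ext fun ⟨x, hx⟩ => ?_
  obtain ⟨a, ha, b, hb, rfl⟩ := Submodule.mem_sup.1 hx
  have h1 := LinearMap.congr_fun (hN (f ∘ₗ Submodule.inclusion le_sup_left)) ⟨a, ha⟩
  have h2 := LinearMap.congr_fun hf ⟨b, hb⟩
  have h3 : (⟨a + b, hx⟩ : ↥(N ⊔ N')) = Submodule.inclusion le_sup_left (⟨a, ha⟩ : N) +
    Submodule.inclusion le_sup_right (⟨b, hb⟩ : N') := rfl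
  rw [h3, map_add]
  exact (congrArg₂ (· + ·) h1 h2).trans (add_zero 0)

/-- Over a left noetherian ring, a torsion module is the directed union of its finitely generated
torsion submodules. -/
theorem exists_fg_leftPerp_of_mem [IsNoetherianRing R] (hC : IsCosilting C) {T : ModuleCat.{u} R}
    (hT : leftPerp C T) (x : T) :
    ∃ N : Submodule R T, N.FG ∧ leftPerp C (ModuleCat.of R N) ∧ x ∈ N := by
  let P : Set (Submodule R T) := {N | N.FG ∧ leftPerp C (ModuleCat.of R N)}
  have hne : P.Nonempty := ⟨⊥, Submodule.fg_bot, fun f => LinearMap.ext fun y => by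
    rw [Subsingleton.elim y 0, map_zero, map_zero]⟩
  have hdir : DirectedOn (· ≤ ·) P := fun N hN N' hN' =>
    ⟨N ⊔ N', ⟨hN.1.sup hN'.1, fun f => leftPerp_sup hN.2 f (hN'.2 _)⟩, le_sup_left, le_sup_right⟩
  let U : Submodule R T := sSup P
  have hU : ∀ y, y ∈ U ↔ ∃ N ∈ P, y ∈ N := fun y => Submodule.mem_sSup_of_directed hne hdir
  have hQ : leftPerp C (ModuleCat.of R (T ⧸ U)) :=
    leftPerp_of_surjective U.mkQ (Submodule.mkQ_surjective U) hT
  -- Lift `N` to a finitely generated `F`. By noetherianity `F ⊓ U` lies in one member `N₀` of `P`,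
  -- so `N₀ ⊔ F` is again torsion and hence inside `U`.
  have hfg : ∀ N : Submodule R (T ⧸ U), N.FG → leftPerp C (ModuleCat.of R N) → N = ⊥ := by
    intro N hN hNt
    obtain ⟨F, hF, rfl⟩ : ∃ F : Submodule R T, F.FG ∧ F.map U.mkQ = N := by
      obtain ⟨s, hs, rfl⟩ := Submodule.fg_def.1 hN
      refine ⟨Submodule.span R (Quotient.out '' s), Submodule.fg_span (hs.image _), ?_⟩
      rw [Submodule.map_span, Set.image_image]
      congr 1
      exact (Set.image_congr fun y _ => Quotient.out_eq y).trans (Set.image_id s)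
    have : IsNoetherian R F := isNoetherian_of_fg_of_noetherian F hF
    have hFU : (F ⊓ U).FG := by
      have := (IsNoetherian.noetherian (U.comap F.subtype)).map F.subtype
      rwa [Submodule.map_comap_subtype] at this
    obtain ⟨N₀, hN₀, hle⟩ := (CompleteLattice.isCompactElement_iff_le_of_directed_sSup_le _ _).1
      ((Submodule.fg_iff_compact _).1 hFU) P hne hdir inf_le_right
    have hmem : N₀ ⊔ F ∈ P := by
      refine ⟨hN₀.1.sup hF, fun f => leftPerp_sup hN₀.2 f ?_⟩
      refine eq_zero_of_leftPerp_of_ker_le hNt (U.mkQ.submoduleMap F)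
        (LinearMap.submoduleMap_surjective _ _) _ ?_
      intro y hy
      have hyU : y.1 ∈ U := (Submodule.Quotient.mk_eq_zero U).1 (congrArg Subtype.val hy)
      have := LinearMap.congr_fun (hN₀.2 (f ∘ₗ Submodule.inclusion le_sup_left))
        ⟨y.1, hle ⟨y.2, hyU⟩⟩
      exact this
    rw [eq_bot_iff, Submodule.map_le_iff_le_comap]
    intro y hy
    exact (Submodule.Quotient.mk_eq_zero U).2 ((hU y).2 ⟨_, hmem, Submodule.mem_sup_right hy⟩)
  -- Rejects of finitely generated submodules of `T ⧸ U` are finitely generated and torsion, hence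
  -- zero. So `T ⧸ U` is both torsion and in `Cogen C`.
  have hcog : Cogen C (ModuleCat.of R (T ⧸ U)) := by
    refine cogen_of_fg hC fun N hN => ?_
    have : IsNoetherian R N := isNoetherian_of_fg_of_noetherian N hN
    let t : Submodule R N := reject C (ModuleCat.of R N)
    have h0 : t.map N.subtype = ⊥ := by
      refine hfg _ ((IsNoetherian.noetherian t).map _) ?_
      exact leftPerp_of_surjective (X := ModuleCat.of R t) (N.subtype.submoduleMap t)
        (LinearMap.submoduleMap_surjective _ _) (leftPerp_reject hC (ModuleCat.of R N))
    have h1 : t = ⊥ := Submodule.map_injective_of_injective N.subtype_injective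
      (h0.trans (Submodule.map_bot _).symm)
    rw [cogen_iff]
    intro y hy
    have hy' : y ∉ reject C (ModuleCat.of R N) := fun h => hy ((Submodule.mem_bot R).1 (h1 ▸ h))
    rw [mem_reject] at hy'
    push Not at hy'
    exact hy'
  have hx := eq_zero_of_leftPerp_of_cogen hQ hcog (U.mkQ x)
  obtain ⟨N, hN, hxN⟩ := (hU x).1 ((Submodule.Quotient.mk_eq_zero U).1 hx)
  exact ⟨N, hN.1, hN.2, hxN⟩

/-- Over a left artinian ring, `A(^{⊥₀} C)` is closed under powers. -/
theorem classA_pi [IsArtinianRing R] (hC : IsCosilting C) {X : ModuleCat.{u} R} (ι : Type u)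
    (hX : classA (leftPerp C) X) : classA (leftPerp C) (ModuleCat.of R (ι → X)) := by
  intro T hT f h
  refine LinearMap.ext fun x => ?_
  obtain ⟨N, hN, hNt, hxN⟩ := exists_fg_leftPerp_of_mem hC hT x.1
  have : IsArtinian R N := isArtinian_of_fg_of_artinian N hN
  obtain ⟨A, ⟨hAt, hxA⟩, hmin⟩ := IsArtinian.set_has_minimal
    {A : Submodule R N | leftPerp C (ModuleCat.of R A) ∧ (⟨x.1, hxN⟩ : N) ∈ A}
    ⟨⊤, leftPerp_of_surjective (X := ModuleCat.of R N) (Y := ModuleCat.of R (⊤ : Submodule R N))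
      Submodule.topEquiv.symm.toLinearMap Submodule.topEquiv.symm.surjective hNt, trivial⟩
  -- Each coordinate of `f` has on `A` a torsion kernel containing `x`, which is all of `A` by
  -- minimality.
  have hA : ∀ a : A, f a.1.1 = 0 := by
    intro a
    funext j
    let p : A →ₗ[R] X := LinearMap.proj j ∘ₗ f ∘ₗ N.subtype ∘ₗ A.subtype
    have hp : leftPerp C (ModuleCat.of R ((LinearMap.ker p).map A.subtype)) :=
      leftPerp_of_surjective (X := ModuleCat.of R (LinearMap.ker p))
        (A.subtype.submoduleMap (LinearMap.ker p)) (LinearMap.submoduleMap_surjective _ _)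
        (hX (ModuleCat.of R A) hAt p)
    have hxp : (⟨x.1, hxN⟩ : N) ∈ (LinearMap.ker p).map A.subtype :=
      ⟨⟨_, hxA⟩, congrFun x.2 j, rfl⟩
    have hle : (LinearMap.ker p).map A.subtype ≤ A := Submodule.map_subtype_le A _
    have heq : (LinearMap.ker p).map A.subtype = A :=
      hle.eq_of_not_lt (hmin _ ⟨hp, hxp⟩)
    obtain ⟨b, hb, hba⟩ := heq.ge a.2
    rw [← Subtype.ext hba]
    exact hb
  let e : A →ₗ[R] LinearMap.ker f := (N.subtype ∘ₗ A.subtype).codRestrict _ hA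
  exact LinearMap.congr_fun (hAt (h ∘ₗ e)) ⟨_, hxA⟩

end FinitelyGenerated

/-! ### Injective envelopes inside an injective module -/

section Envelope

/-- Every submodule of an injective module is essential in some injective submodule. -/
theorem exists_injective_essential {J : Type u} [AddCommGroup J] [Module R J]
    (hJ : Module.Injective R J) (Q : Submodule R J) :
    ∃ E : Submodule R J, Q ≤ E ∧ Module.Injective R E ∧ ∀ L ≤ E, Q ⊓ L = ⊥ → L = ⊥ := by
  obtain ⟨E, -, hE⟩ := zorn_le_nonempty₀
    {E : Submodule R J | Q ≤ E ∧ ∀ L ≤ E, Q ⊓ L = ⊥ → L = ⊥} (fun c hc hch E hEc => by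
      refine ⟨sSup c, ⟨(hc hEc).1.trans (le_sSup hEc), fun L hL hQL => ?_⟩, fun _ => le_sSup⟩
      refine (Submodule.eq_bot_iff _).2 fun x hx => ?_
      obtain ⟨E', hE', hxE'⟩ := (Submodule.mem_sSup_of_directed ⟨E, hEc⟩ hch.directedOn).1 (hL hx)
      refine Submodule.span_singleton_eq_bot.1 ((hc hE').2 (Submodule.span R {x}) ?_ ?_)
      · rwa [Submodule.span_singleton_le_iff_mem]
      · refine eq_bot_iff.2 (le_trans (inf_le_inf_left Q ?_) hQL.le)
        rwa [Submodule.span_singleton_le_iff_mem]) Q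
    ⟨le_rfl, fun L hL h => by rwa [inf_eq_right.2 hL] at h⟩
  obtain ⟨L, -, hL⟩ := zorn_le_nonempty₀ {L : Submodule R J | Q ⊓ L = ⊥} (fun c hc hch L hLc => by
      refine ⟨sSup c, (Submodule.eq_bot_iff _).2 ?_, fun _ => le_sSup⟩
      rintro x ⟨hxQ, hx⟩
      obtain ⟨L', hL', hxL'⟩ := (Submodule.mem_sSup_of_directed ⟨L, hLc⟩ hch.directedOn).1 hx
      exact (Submodule.eq_bot_iff _).1 (hc hL') x ⟨hxQ, hxL'⟩) ⊥ (inf_bot_eq _)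
  obtain ⟨⟨hQE, hess⟩, hEmax⟩ := hE
  have hEL : E ⊓ L = ⊥ := hess _ inf_le_left (by
    rw [← inf_assoc, inf_eq_left.2 hQE]; exact hL.1)
  obtain ⟨h, hh⟩ := exists_extension_of_injective hJ (L.mkQ ∘ₗ E.subtype) (by
    rw [← LinearMap.ker_eq_bot, LinearMap.ker_eq_bot']
    intro x hx
    have hxL : x.1 ∈ L := (Submodule.Quotient.mk_eq_zero L).1 hx
    exact Subtype.ext ((Submodule.eq_bot_iff _).1 hEL x.1 ⟨x.2, hxL⟩)) E.subtype
  -- `E` is a maximal essential extension of `Q` and `L` a maximal submodule meeting `Q` trivially.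
  -- Maximality of `L` makes `im r` essential over `Q`, maximality of `E` then gives `im r = E`, so
  -- `r` retracts `J` onto `E`.
  let r : J →ₗ[R] J := h ∘ₗ L.mkQ
  have hr : ∀ x ∈ E, r x = x := fun x hx => LinearMap.congr_fun hh ⟨x, hx⟩
  have hEr : E ≤ LinearMap.range r := fun x hx => ⟨x, hr x hx⟩
  have hrE : LinearMap.range r ≤ E := by
    refine hEmax ⟨hQE.trans hEr, fun L' hL' hQL' => ?_⟩ hEr
    have h1 : Q ⊓ L'.comap r = ⊥ := by
      refine (Submodule.eq_bot_iff _).2 ?_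
      rintro x ⟨hxQ, hx⟩
      have hx' : r x ∈ L' := hx
      rw [hr x (hQE hxQ)] at hx'
      exact (Submodule.eq_bot_iff _).1 hQL' x ⟨hxQ, hx'⟩
    have h2 : L ≤ L'.comap r := fun x hx => by
      have : L.mkQ x = 0 := (Submodule.Quotient.mk_eq_zero L).2 hx
      simp [r, this]
    have h3 : L'.comap r ≤ L := hL.2 h1 h2
    refine (Submodule.eq_bot_iff _).2 fun y hy => ?_
    obtain ⟨x, rfl⟩ := hL' hy
    have : L.mkQ x = 0 := (Submodule.Quotient.mk_eq_zero L).2 (h3 hy)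
    simp [r, this]
  refine ⟨E, hQE, ⟨fun {X Y} _ _ _ _ f hf g => ?_⟩, hess⟩
  obtain ⟨k, hk⟩ := exists_extension_of_injective hJ f hf (E.subtype ∘ₗ g)
  refine ⟨(r ∘ₗ k).codRestrict E fun y => hrE ⟨_, rfl⟩, fun x => Subtype.ext ?_⟩
  have h1 : k (f x) = (g x).1 := LinearMap.congr_fun hk x
  change r (k (f x)) = _
  rw [h1, hr _ (g x).2]

theorem exists_embedding_injective {E : ModuleCat.{u} R} (hE : IsInjCogenerator E)
    (M : ModuleCat.{u} R) :
    ∃ (I : ModuleCat.{u} R) (f : M →ₗ[R] I), Module.Injective R I ∧ Function.Injective f := by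
  obtain ⟨ι, f, hf⟩ := hE.cogen M
  have := hE.inj
  exact ⟨ModuleCat.of R (ι → E), f, inferInstanceAs (Module.Injective R (ι → E)), hf⟩

theorem exists_injCopresentation_essential {E : ModuleCat.{u} R} (hE : IsInjCogenerator E)
    (M : ModuleCat.{u} R) :
    ∃ (I₀ I₁ : ModuleCat.{u} R) (i : M →ₗ[R] I₀) (σ : I₀ →ₗ[R] I₁),
      IsInjCopresentation i σ ∧ IsEssential (LinearMap.range σ) := by
  obtain ⟨I₀, i, hI₀, hi⟩ := exists_embedding_injective hE M
  obtain ⟨J, f, hJ, hf⟩ :=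
    exists_embedding_injective hE (ModuleCat.of R (I₀ ⧸ LinearMap.range i))
  let p : I₀ →ₗ[R] J := f ∘ₗ (LinearMap.range i).mkQ
  obtain ⟨I, hle, hI, hess⟩ := exists_injective_essential hJ (LinearMap.range p)
  refine ⟨I₀, ModuleCat.of R I, i, p.codRestrict I fun x => hle ⟨x, rfl⟩,
    ⟨hI₀, hI, hi, fun x => ?_⟩, fun L hL => ?_⟩
  · have h1 : f ((LinearMap.range i).mkQ x) = 0 ↔ x ∈ LinearMap.range i := by
      rw [map_eq_zero_iff f hf]
      exact Submodule.Quotient.mk_eq_zero _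
    exact Subtype.ext_iff.trans h1
  · have h1 : L.map I.subtype = ⊥ := by
      refine hess _ (Submodule.map_subtype_le I L) ((Submodule.eq_bot_iff _).2 ?_)
      rintro _ ⟨⟨x, hx⟩, ⟨y, hy, rfl⟩⟩
      have : y ∈ LinearMap.range (p.codRestrict I fun x => hle ⟨x, rfl⟩) ⊓ L :=
        ⟨⟨x, Subtype.ext hx⟩, hy⟩
      rw [hL] at this
      exact congrArg Subtype.val ((Submodule.mem_bot R).1 this)
    exact Submodule.map_injective_of_injective I.subtype_injective
      (h1.trans (Submodule.map_bot _).symm)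

end Envelope

end Cosilting

/-! ### The main theorem -/

theorem mainTheorem5 {R : Type u} [Ring R] (C : ModuleCat.{u} R) (hC : Cosilting.IsCosilting C)
    {C₁ C₀ E : ModuleCat.{u} R} (k : C₁ →ₗ[R] C₀) (g : C₀ →ₗ[R] E)
    (hg : Cosilting.IsMinApproxSequence C k g) :
    (∀ {I₀ I₁ : ModuleCat.{u} R} (i : C₀ →ₗ[R] I₀) (σ : I₀ →ₗ[R] I₁),
        Cosilting.IsMinInjCopresentation i σ →
        Cosilting.classA (Cosilting.leftPerp C) = Cosilting.copresClass σ) ∧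
      (IsArtinianRing R →
        Cosilting.IsCosiltingClass (Cosilting.classA (Cosilting.leftPerp C))) := by
  have heq : ∀ {I₀ I₁ : ModuleCat.{u} R} (i : C₀ →ₗ[R] I₀) (σ : I₀ →ₗ[R] I₁),
      Cosilting.IsInjCopresentation i σ → Cosilting.IsEssential (LinearMap.range σ) →
      Cosilting.classA (Cosilting.leftPerp C) = Cosilting.copresClass σ := by
    intro I₀ I₁ i σ hσ hess
    funext X
    exact propext ⟨Cosilting.copresClass_of_classA hC hg.injCogenerator.inj hg.cover hσ hess,
      Cosilting.classA_of_copresClass hσ hg.cover.mem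
        (Cosilting.cogen_of_cover hg.injCogenerator hg.cover (Cosilting.cogen_self C))⟩
  refine ⟨fun i σ hσ => heq i σ hσ.toIsInjCopresentation hσ.essential₁, fun hR => ?_⟩
  obtain ⟨I₀, I₁, i, σ, hσ, hess⟩ :=
    Cosilting.exists_injCopresentation_essential hg.injCogenerator C₀
  have h := heq i σ hσ hess
  rw [h]
  refine Cosilting.isCosiltingClass_copresClass hσ hg.injCogenerator ?_ fun X ι hX => ?_
  -- Maps from torsion modules to `C₀` are zero, so their kernels are the whole torsion source.
  · rw [← h]
    intro T hT f h'
    ext x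
    have hf : f = 0 := Cosilting.leftPerp_of_cogen hg.cover.mem hT f
    have hx := LinearMap.congr_fun (hT (h' ∘ₗ LinearMap.id.codRestrict (LinearMap.ker f)
      fun y => by simp [hf])) x.1
    exact hx
  · rw [← h] at hX ⊢
    exact Cosilting.classA_pi hC ι hX
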